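/- Let $(U,\delta)$ be a differentially closed field of characteristic $0$ (a model of $\mathrm{DCF}_0$) whose field of constants contains $\mathbb{C}$; write $x'=\delta(x)$. A definable subset of $U$ is a finite Boolean combination of zero sets of finite systems of differential polynomials in one variable with coefficients in $U$. A definable set $X\subseteq U$ is strongly minimal if it is infinite and, for every definable $Y\subseteq X$, either $Y$ or $X\setminus Y$ is finite. Let $f\in\mathbb{C}(z)$. Then the set $$\{\,z\in U : z''=z'f(z),\ z'\neq 0\,\}$$ is strongly minimal if and only if $f\neq \dfrac{dg}{dz}$ for every $g\in\mathbb{C}(z)$. -/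

import Mathlib

open scoped Differential

noncomputable section

namespace Poizat

/-- Value at `a` of a differential polynomial in one differential indeterminate: the variable
`X i` of `MvPolynomial ℕ U` stands for the `i`-th derivative of the indeterminate. -/
def diffEval {U : Type*} [Field U] [Differential U] (P : MvPolynomial ℕ U) (a : U) : U :=
  MvPolynomial.eval (fun i : ℕ => (fun x : U => x′)^[i] a) P

/-- Order of a differential polynomial: the largest `i` such that the `i`-th derivative of the
indeterminate occurs in it, and `⊥` if it is an element of the coefficient field. -/
def diffOrder {U : Type*} [Field U] (P : MvPolynomial ℕ U) : WithBot ℕ :=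
  P.vars.max

/-- Models of `DCF₀` (Blum's axioms): a field `U` of characteristic zero with a derivation such that
for all differential polynomials `P`, `Q` over `U` with `Q ≠ 0` and `ord Q < ord P`, there is `a`
in `U` with `P(a) = 0` and `Q(a) ≠ 0`. -/
structure IsDifferentiallyClosed (U : Type*) [Field U] [Differential U] : Prop where
  charZero : CharZero U
  exists_zero : ∀ P Q : MvPolynomial ℕ U, Q ≠ 0 → diffOrder Q < diffOrder P →
    ∃ a : U, diffEval P a = 0 ∧ diffEval Q a ≠ 0

/-- Kolchin closed subsets of `U`: zero sets of finite systems of differential polynomials. -/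
def IsKolchinClosed {U : Type*} [Field U] [Differential U] (S : Set U) : Prop :=
  ∃ F : Finset (MvPolynomial ℕ U), S = {a | ∀ P ∈ F, diffEval P a = 0}

/-- Definable subsets of `U` (parameters from `U` allowed): finite Boolean combinations of Kolchin
closed sets. -/
def IsDefinable {U : Type*} [Field U] [Differential U] (S : Set U) : Prop :=
  S ∈ BooleanSubalgebra.closure {T : Set U | IsKolchinClosed T}

/-- A definable set is strongly minimal if it is infinite and each of its definable subsets is
finite or has finite complement in it. -/
def IsStronglyMinimal {U : Type*} [Field U] [Differential U] (S : Set U) : Prop :=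
  IsDefinable S ∧ S.Infinite ∧
    ∀ Y : Set U, Y ⊆ S → IsDefinable Y → Y.Finite ∨ (S \ Y).Finite

/-- The derivative `dg/dz` of a rational function `g(z)`, by the quotient rule. -/
def ratDeriv {k : Type*} [Field k] (g : RatFunc k) : RatFunc k :=
  (algebraMap (Polynomial k) (RatFunc k)
      (Polynomial.derivative g.num * g.denom - g.num * Polynomial.derivative g.denom)) /
    (algebraMap (Polynomial k) (RatFunc k) g.denom) ^ 2

/-- Value `f(a)` of a rational function at a point of an extension field: the value of the reduced
numerator divided by that of the reduced denominator. (This is `RatFunc.eval`, without its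
restriction that both fields live in the same universe.) -/
def ratEval {k : Type*} [Field k] {U : Type*} [Field U] [Algebra k U] (f : RatFunc k) (a : U) : U :=
  Polynomial.aeval a f.num / Polynomial.aeval a f.denom

/-- The solution set in `U` of `z'' = z' f(z)`, `z' ≠ 0`. When the elements of `ℂ` are constants of
`U`, a solution is not in `ℂ`, so it is never a pole of `f` and `f(z)` has its literal meaning. -/
def solutionSet (U : Type*) [Field U] [Differential U] [Algebra ℂ U] (f : RatFunc ℂ) : Set U :=
  {z | z′′ = z′ * ratEval f z ∧ z′ ≠ 0}

end Poizat

end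

/-! If `f = dg/dz`, then `z' = g(z)` and `z' = g(z) + 1` both imply the equation. After adjusting
constant `g`, this gives two disjoint infinite definable subsets, so strong minimality fails
(`not_isStronglyMinimal_of_ratDeriv`).

Conversely, write `f = N/D`. On solutions every differential polynomial becomes, up to a power of
`D(z)`, a polynomial `p(z, z')`, so it suffices that each curve `p = 0` with `p ≠ 0` contains
finitely many solutions (`finite_setOf_evalEval_eq_zero`). Differentiating `p(z, z') = 0` along the
vector field and subtracting a multiple of `p` yields a relation of lower degree in `z'`, unless
this remainder is zero. A zero remainder, read on the constant coefficient `a` of `p`, gives `n f =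
δa/a - δb/b - (r/b)'`, where `b, r` are the top two coefficients, `n` is the degree, `δ` acts on
coefficients and the prime is `d/dx`.

Hermite reduction shows that a non-derivative `f` is a derivative plus a fraction with a simple pole
at some `c` in `ℂ`. As `c` is constant, `δ` kills `X - c`, so the logarithmic derivatives are
regular at `c`; a derivative never has a simple pole. Hence the identity is impossible
(`darboux_identity_ne`). -/

open scoped Differential
open Polynomial

namespace Poizat

/-! ### Local analysis of poles at a constant point. -/

section Poles

variable {K : Type*} [Field K]

/-- A derivation that kills `X - C a` preserves the factors `(X - C a) ^ n`. -/
lemma exists_eq_pow_mul_eval_ne_zero (δ : Derivation ℤ K[X] K[X]) {a : K}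
    (hδ : δ (X - C a) = 0) {p : K[X]} (hp : p ≠ 0) :
    ∃ (n : ℕ) (q : K[X]), p = (X - C a) ^ n * q ∧ δ p = (X - C a) ^ n * δ q ∧ q.eval a ≠ 0 := by
  obtain ⟨q, hq, hdvd⟩ := p.exists_eq_pow_rootMultiplicity_mul_and_not_dvd hp a
  refine ⟨_, q, hq, ?_, fun h => hdvd (dvd_iff_isRoot.2 h)⟩
  conv_lhs => rw [hq]
  simp [Derivation.leibniz, Derivation.leibniz_pow, hδ]

/-- The derivative of a fraction plus a difference of two logarithmic derivatives (for a derivation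
killing `X - C a`) does not have a simple pole at `a`. -/
lemma not_simple_pole [CharZero K] (δ : Derivation ℤ K[X] K[X]) {a : K}
    (hδ : δ (X - C a) = 0) {A B u v p q : K[X]} (hv : v ≠ 0) (hp : p ≠ 0) (hq : q ≠ 0)
    (hA : A.eval a ≠ 0) (hB : B.eval a ≠ 0)
    (h : A * v ^ 2 * (p * q) = (X - C a) * B * ((derivative u * v - u * derivative v) * (p * q) +
      v ^ 2 * (δ p * q - p * δ q))) : False := by
  have ht : X - C a ≠ 0 := X_sub_C_ne_zero a
  obtain ⟨i, p₀, hp₀, hdp, hpa⟩ := exists_eq_pow_mul_eval_ne_zero δ hδ hp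
  obtain ⟨j, q₀, hq₀, hdq, hqa⟩ := exists_eq_pow_mul_eval_ne_zero δ hδ hq
  obtain ⟨k, v₀, hv₀, -, hva⟩ := exists_eq_pow_mul_eval_ne_zero δ hδ hv
  obtain ⟨E, hE⟩ : ∃ E, E = δ p₀ * q₀ - p₀ * δ q₀ := ⟨_, rfl⟩
  have h1 : A * v ^ 2 * (p₀ * q₀) = (X - C a) * B *
      ((derivative u * v - u * derivative v) * (p₀ * q₀) + v ^ 2 * E) := by
    apply mul_left_cancel₀ (pow_ne_zero (i + j) ht)
    rw [hdp, hdq, hp₀, hq₀] at h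
    rw [hE]
    linear_combination h
  -- If `u/v` is regular at `a`, the right side vanishes at `a` and the left side does not.
  by_cases hu : (X - C a) ^ k ∣ u
  · obtain ⟨w, rfl⟩ := hu
    have h2 : A * v₀ ^ 2 * (p₀ * q₀) = (X - C a) * B *
        ((derivative w * v₀ - w * derivative v₀) * (p₀ * q₀) + v₀ ^ 2 * E) := by
      apply mul_left_cancel₀ (pow_ne_zero (2 * k) ht)
      rw [hv₀, derivative_mul, derivative_mul] at h1
      linear_combination h1
    simpa [hA, hva, hpa, hqa] using congrArg (eval a) h2
  · have hu0 : u ≠ 0 := by rintro rfl; simp at hu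
    obtain ⟨l, u₀, hu₀, -, hua⟩ := exists_eq_pow_mul_eval_ne_zero δ hδ hu0
    have hlk : l < k := by
      by_contra hlk
      exact hu (hu₀ ▸ (pow_dvd_pow _ (not_lt.1 hlk)).mul_right _)
    -- Here `u/v` has a pole of order `m + 1`, so its derivative has one of order `m + 2 ≥ 2`, with
    -- leading factor `-(m + 1)`, nonzero in characteristic `0`; nothing else can cancel it.
    obtain ⟨m, rfl⟩ : ∃ m, k = l + (m + 1) := ⟨k - l - 1, by omega⟩
    have h2 : A * (X - C a) ^ (m + 1) * v₀ ^ 2 * (p₀ * q₀) = B *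
        (((derivative u₀ * v₀ - u₀ * derivative v₀) * (X - C a) - ((m + 1 : ℕ) : K[X]) * u₀ * v₀) *
          (p₀ * q₀) + (X - C a) ^ (m + 2) * v₀ ^ 2 * E) := by
      apply mul_left_cancel₀ (pow_ne_zero (2 * l + (m + 1)) ht)
      rw [hv₀, hu₀, pow_add, derivative_mul, derivative_mul, derivative_mul,
        derivative_X_sub_C_pow a (m + 1)] at h1
      simp only [Nat.add_sub_cancel, map_natCast] at h1
      linear_combination h1
    have h3 := congrArg (eval a) h2
    have hm : ((m + 1 : ℕ) : K) ≠ 0 := Nat.cast_ne_zero.2 m.succ_ne_zero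
    simp [-Nat.cast_add, hB, hua, hva, hpa, hqa, hm] at h3

end Poles

/-! ### Derivatives of rational functions and Hermite reduction. -/

section RatFunc

variable {k : Type*} [Field k]

local notation "ι" => algebraMap (Polynomial k) (RatFunc k)

lemma algebraMap_ratFunc_ne_zero {p : k[X]} (hp : p ≠ 0) : ι p ≠ 0 :=
  (map_ne_zero_iff _ (RatFunc.algebraMap_injective k)).2 hp

lemma ratDeriv_div (a : k[X]) {b : k[X]} (hb : b ≠ 0) :
    ratDeriv (ι a / ι b) = ι (derivative a * b - a * derivative b) / ι b ^ 2 := by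
  obtain ⟨g, hg⟩ : ∃ g, g = ι a / ι b := ⟨_, rfl⟩
  rw [← hg, ratDeriv]
  have hd := g.denom_ne_zero
  have h : g.num * b = a * g.denom := by
    apply RatFunc.algebraMap_injective k
    have := g.num_div_denom
    rw [hg] at this ⊢
    rw [div_eq_div_iff (algebraMap_ratFunc_ne_zero (RatFunc.denom_ne_zero _))
      (algebraMap_ratFunc_ne_zero hb)] at this
    simpa using this
  rw [div_eq_div_iff (pow_ne_zero 2 (algebraMap_ratFunc_ne_zero hd))
    (pow_ne_zero 2 (algebraMap_ratFunc_ne_zero hb)), ← map_pow, ← map_pow, ← map_mul, ← map_mul]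
  congr 1
  have h' := congrArg derivative h
  rw [derivative_mul, derivative_mul] at h'
  linear_combination b * g.denom * h' - (derivative b * g.denom + b * derivative g.denom) * h

lemma ratDeriv_add (g h : RatFunc k) : ratDeriv (g + h) = ratDeriv g + ratDeriv h := by
  conv_lhs => rw [← g.num_div_denom, ← h.num_div_denom, div_add_div _ _
    (algebraMap_ratFunc_ne_zero g.denom_ne_zero) (algebraMap_ratFunc_ne_zero h.denom_ne_zero),
    ← map_mul, ← map_mul, ← map_mul, ← map_add,
    ratDeriv_div _ (mul_ne_zero g.denom_ne_zero h.denom_ne_zero)]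
  have h1 := algebraMap_ratFunc_ne_zero g.denom_ne_zero
  have h2 := algebraMap_ratFunc_ne_zero h.denom_ne_zero
  simp only [ratDeriv, derivative_mul, map_sub, map_add, map_mul]
  field_simp
  ring

/-- Hermite reduction over an algebraically closed field: a fraction is a derivative, or it is the
sum of a derivative and of a fraction with a simple pole. -/
lemma exists_ratDeriv_or_simple_pole [IsAlgClosed k] [CharZero k] (a b : k[X]) (hb : b ≠ 0) :
    (∃ g, ι a / ι b = ratDeriv g) ∨ ∃ (g : RatFunc k) (c : k) (A B : k[X]),
      A.eval c ≠ 0 ∧ B.eval c ≠ 0 ∧ ι a / ι b = ratDeriv g + ι A / ι ((X - C c) * B) := by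
  induction hn : b.natDegree using Nat.strong_induction_on generalizing a b with
  | _ n ih =>
  obtain rfl | hn0 := Nat.eq_zero_or_pos n
  · left
    obtain ⟨s, rfl⟩ := natDegree_eq_zero.1 hn
    have hs : s ≠ 0 := by simpa using hb
    refine ⟨ι (∑ i ∈ a.support, C (a.coeff i / (i + 1) / s) * X ^ (i + 1)) / ι 1, ?_⟩
    rw [ratDeriv_div _ one_ne_zero, div_eq_iff (algebraMap_ratFunc_ne_zero hb)]
    simp only [map_one, one_pow, div_one, derivative_one, mul_zero, mul_one, sub_zero,
      ← map_mul, derivative_sum]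
    congr 1
    conv_lhs => rw [a.as_sum_support_C_mul_X_pow]
    rw [Finset.sum_mul]
    refine Finset.sum_congr rfl fun i _ => ?_
    have hi : (i : k) + 1 ≠ 0 := by exact_mod_cast i.succ_ne_zero
    rw [derivative_C_mul_X_pow, mul_right_comm, ← C_mul]
    congr 2
    push_cast
    field_simp
  · obtain ⟨c, hc⟩ := IsAlgClosed.exists_root b
      (by rw [degree_eq_natDegree hb]; exact_mod_cast (hn ▸ hn0).ne')
    obtain ⟨w, hw, hdvd⟩ := b.exists_eq_pow_rootMultiplicity_mul_and_not_dvd hb c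
    have hwc : w.eval c ≠ 0 := fun h => hdvd (dvd_iff_isRoot.2 h)
    have hw0 : w ≠ 0 := by rintro rfl; simp at hwc
    have hpos := (rootMultiplicity_pos hb).2 hc
    obtain ⟨m, hm⟩ : ∃ m, b.rootMultiplicity c = m + 1 := ⟨_, (Nat.succ_pred_eq_of_pos hpos).symm⟩
    rw [hm] at hw
    have ht : X - C c ≠ 0 := X_sub_C_ne_zero c
    have ht' := algebraMap_ratFunc_ne_zero ht
    have hw' := algebraMap_ratFunc_ne_zero hw0
    have hlt : ((X - C c) ^ m * w).natDegree < n := by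
      rw [← hn, hw, natDegree_mul (pow_ne_zero _ ht) hw0, natDegree_mul (pow_ne_zero _ ht) hw0,
        natDegree_pow, natDegree_pow, natDegree_X_sub_C]
      omega
    have hbm : (X - C c) ^ m * w ≠ 0 := mul_ne_zero (pow_ne_zero _ ht) hw0
    by_cases ha : a.eval c = 0
    · obtain ⟨a₁, rfl⟩ := dvd_iff_isRoot.2 ha
      have : ι ((X - C c) * a₁) / ι b = ι a₁ / ι ((X - C c) ^ m * w) := by
        rw [hw]; simp only [map_mul, map_pow]; field_simp; ring
      rw [this]
      exact ih _ hlt a₁ _ hbm rfl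
    obtain rfl | hm0 := Nat.eq_zero_or_pos m
    · right
      refine ⟨ι 0 / ι 1, c, a, w, ha, hwc, ?_⟩
      rw [ratDeriv_div _ one_ne_zero, hw]
      simp
    -- With `s = a(c)/w(c)`, the term `s/(X - c)^(m+1)` splits off as the derivative of `-(s/m)/(X -
    -- c)^m`; the rest cancels a factor `X - c` of the denominator.
    obtain ⟨a₁, ha₁⟩ : X - C c ∣ a - C (a.eval c / w.eval c) * w := by
      rw [dvd_iff_isRoot]; simp [hwc]
    have hmk : (m : k) ≠ 0 := Nat.cast_ne_zero.2 hm0.ne'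
    have hsplit : ι a / ι b = ratDeriv (ι (C (-(a.eval c / w.eval c) / m)) / ι ((X - C c) ^ m)) +
        ι a₁ / ι ((X - C c) ^ m * w) := by
      obtain ⟨s, hs⟩ : ∃ s, s = a.eval c / w.eval c := ⟨_, rfl⟩
      rw [← hs] at ha₁ ⊢
      have e : a = C s * w + (X - C c) * a₁ := by rw [← ha₁]; ring
      obtain ⟨r, rfl⟩ : ∃ r, m = r + 1 := ⟨m - 1, by omega⟩
      have hC : C (-s / (r + 1 : ℕ)) * C ((r + 1 : ℕ) : k) = - C s := by
        rw [← C_mul, div_mul_cancel₀ _ hmk, C_neg]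
      rw [ratDeriv_div _ (pow_ne_zero _ ht), hw, e, derivative_C, derivative_X_sub_C_pow]
      rw [show (0 * (X - C c) ^ (r + 1) - C (-s / (r + 1 : ℕ)) *
        (C ((r + 1 : ℕ) : k) * (X - C c) ^ (r + 1 - 1))) = C s * (X - C c) ^ r by
          rw [← mul_assoc, hC]; simp]
      simp only [map_mul, map_add, map_pow]
      field_simp
      ring
    rw [hsplit]
    obtain ⟨g, hg⟩ | ⟨g, c', A, B, hA, hB, hg⟩ := ih _ hlt a₁ _ hbm rfl
    · exact Or.inl ⟨_, by rw [hg, ← ratDeriv_add]⟩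
    · exact Or.inr ⟨_, c', A, B, hA, hB, by rw [hg, ← add_assoc, ← ratDeriv_add]⟩

end RatFunc

/-- The derivation of `A[X]` acting on coefficients by a given derivation of `A`. -/
noncomputable def coeffDerivation {A : Type*} [CommRing A] (d : Derivation ℤ A A) :
    Derivation ℤ A[X] A[X] :=
  letI : Differential A := ⟨d⟩
  Differential.mapCoeffs

lemma coeff_coeffDerivation {A : Type*} [CommRing A] (d : Derivation ℤ A A) (p : A[X]) (n : ℕ) :
    (coeffDerivation d p).coeff n = d (p.coeff n) := rfl

lemma coeffDerivation_monomial {A : Type*} [CommRing A] (d : Derivation ℤ A A) (n : ℕ) (a : A) :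
    coeffDerivation d (monomial n a) = monomial n (d a) := by
  let : Differential A := ⟨d⟩
  exact Differential.mapCoeffs_monomial n a

/-! ### The vector field of the equation and its invariant curves. -/

section VectorField

variable {U : Type*} [Field U] [Differential U]

@[simp]
lemma coeff_coeffDerivation_mapCoeffs (p : U[X][X]) (n : ℕ) :
    (coeffDerivation Differential.mapCoeffs p).coeff n = Differential.mapCoeffs (p.coeff n) :=
  rfl

@[simp]
lemma coeffDerivation_mapCoeffs_monomial (n : ℕ) (a : U[X]) :
    coeffDerivation Differential.mapCoeffs (monomial n a) =
      monomial n (Differential.mapCoeffs a) :=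
  coeffDerivation_monomial _ n a

/-- The action on `U[x][y]` of `D` times the derivation with `x' = y` and `D(x) y' = y N(x)`. -/
noncomputable def vectorField (D N : U[X]) (p : U[X][X]) : U[X][X] :=
  C D * coeffDerivation Differential.mapCoeffs p +
    X * (C D * coeffDerivation (derivative'.restrictScalars ℤ) p) +
    C N * (X * derivative p)

lemma vectorField_add (D N : U[X]) (p q : U[X][X]) :
    vectorField D N (p + q) = vectorField D N p + vectorField D N q := by
  simp only [vectorField, map_add]
  ring

lemma vectorField_coeff_zero (D N : U[X]) (p : U[X][X]) :
    (vectorField D N p).coeff 0 = D * Differential.mapCoeffs (p.coeff 0) := by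
  simp [vectorField]

lemma vectorField_coeff_succ (D N : U[X]) (p : U[X][X]) (n : ℕ) :
    (vectorField D N p).coeff (n + 1) = D * Differential.mapCoeffs (p.coeff (n + 1)) +
      D * derivative (p.coeff n) + N * (((n + 1 : ℕ) : U[X]) * p.coeff (n + 1)) := by
  simp only [vectorField, coeff_add, coeff_C_mul, coeff_X_mul, coeff_coeffDerivation,
    coeff_coeffDerivation_mapCoeffs, coeff_derivative, Derivation.restrictScalars_apply, derivative'_apply]
  push_cast
  ring

lemma deriv_eval (a : U[X]) (z : U) :
    (a.eval z)′ = (Differential.mapCoeffs a).eval z + (derivative a).eval z * z′ := by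
  simpa using Differential.deriv_aeval_eq z a

/-- The chain rule along a solution: a relation `p(z, z') = 0` propagates to `vectorField D N p`. -/
lemma mul_deriv_evalEval {D N : U[X]} {z : U} (hz : D.eval z * z′′ = N.eval z * z′)
    (p : U[X][X]) :
    D.eval z * (p.evalEval z z′)′ = (vectorField D N p).evalEval z z′ := by
  induction p using Polynomial.induction_on' with
  | add p q hp hq => rw [vectorField_add, evalEval_add, evalEval_add, map_add, mul_add, hp, hq]
  | monomial n a =>
    have h (m : ℕ) (b : U[X]) : (monomial m b).evalEval z z′ = b.eval z * z′ ^ m := by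
      simp [evalEval, ← C_mul_X_pow_eq_monomial]
    simp only [vectorField, coeffDerivation_monomial, coeffDerivation_mapCoeffs_monomial, derivative_monomial, evalEval_add,
      evalEval_mul, h, evalEval_C, evalEval_X, Derivation.leibniz, Derivation.leibniz_pow,
      smul_eq_mul, deriv_eval, Derivation.restrictScalars_apply, derivative'_apply, eval_mul,
      eval_natCast, nsmul_eq_mul]
    obtain _ | n := n
    · simp; ring
    · simp only [Nat.add_sub_cancel]
      linear_combination a.eval z * ((n + 1 : ℕ) : U) * z′ ^ n * hz

/-- If the relevant Darboux identity has no solutions then a curve contains finitely many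
solutions of the differential equation. -/
lemma finite_setOf_evalEval_eq_zero {D N : U[X]} {S : Set U}
    (hS : ∀ z ∈ S, D.eval z * z′′ = N.eval z * z′) (hS' : ∀ z ∈ S, z′ ≠ 0)
    (H : ∀ (n : ℕ) (a b r : U[X]), n ≠ 0 → a ≠ 0 → b ≠ 0 →
      b ^ 2 * (D * Differential.mapCoeffs a) ≠ (b * (D * Differential.mapCoeffs b +
        D * derivative r + N * ((n : U[X]) * b)) - D * derivative b * r) * a)
    (p : U[X][X]) (hp : p ≠ 0) : {z ∈ S | p.evalEval z z′ = 0}.Finite := by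
  induction hn : p.natDegree using Nat.strong_induction_on generalizing p with
  | _ n ih =>
  obtain _ | n := n
  · obtain ⟨a, rfl⟩ := natDegree_eq_zero.1 hn
    have ha : a ≠ 0 := by simpa using hp
    exact (finite_setOfPred_isRoot ha).subset fun z hz => by simpa [evalEval_C] using hz.2
  -- A factor `y` of `p` can be removed because `z' ≠ 0` on `S`.
  by_cases h0 : p.coeff 0 = 0
  · obtain ⟨q, rfl⟩ := X_dvd_iff.2 h0
    have hq : q ≠ 0 := right_ne_zero_of_mul hp
    refine (ih n (by omega) q hq ?_).subset fun z hz => ⟨hz.1, ?_⟩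
    · rw [natDegree_X_mul hq] at hn; omega
    · simpa [hS' z hz.1] using hz.2
  obtain ⟨b, hb⟩ : ∃ b, b = p.coeff (n + 1) := ⟨_, rfl⟩
  obtain ⟨r, hr⟩ : ∃ r, r = p.coeff n := ⟨_, rfl⟩
  have hb0 : b ≠ 0 := by rw [hb, ← hn]; exact leadingCoeff_ne_zero.2 hp
  obtain ⟨c, hc⟩ : ∃ c, c = b * (D * Differential.mapCoeffs b + D * derivative r +
    N * (((n + 1 : ℕ) : U[X]) * b)) - D * derivative b * r := ⟨_, rfl⟩
  -- Pseudo-division by `p`: the vector field raises the degree in `y` by at most one, and the two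
  -- multiples of `p` cancel the coefficients of `y^(n+2)` and `y^(n+1)`.
  obtain ⟨q, hq⟩ : ∃ q, q = C (b ^ 2) * vectorField D N p -
    (X * (C (D * derivative b * b) * p) + C c * p) := ⟨_, rfl⟩
  have hq0 : q ≠ 0 := by
    intro h
    apply H (n + 1) (p.coeff 0) b r n.succ_ne_zero h0 hb0
    -- The constant coefficient of `q = 0` is exactly the identity excluded by `H`.
    have := congrArg (coeff · 0) (hq.symm.trans h)
    simp only [coeff_sub, coeff_add, vectorField_coeff_zero, mul_coeff_zero,
      coeff_X_zero, zero_mul, zero_add, coeff_zero, coeff_C_zero] at this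
    rw [← hc]
    linear_combination this
  have hqn : q.natDegree < n + 1 := by
    refine Nat.lt_succ_of_le (natDegree_le_iff_coeff_eq_zero.2 fun m hm => ?_)
    obtain ⟨m, rfl⟩ : ∃ m', m = m' + 1 := ⟨m - 1, by omega⟩
    rw [hq]
    simp only [coeff_sub, coeff_add, coeff_C_mul, vectorField_coeff_succ, coeff_X_mul]
    obtain rfl | rfl | hlt : m = n ∨ m = n + 1 ∨ n + 1 < m := by omega
    · rw [← hb, ← hr, hc]
      ring
    · rw [← hb, coeff_eq_zero_of_natDegree_lt (show p.natDegree < n + 1 + 1 by omega)]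
      simp
      ring
    · rw [coeff_eq_zero_of_natDegree_lt (show p.natDegree < m + 1 by omega),
        coeff_eq_zero_of_natDegree_lt (show p.natDegree < m by omega)]
      simp
  refine (ih _ hqn q hq0 rfl).subset fun z hz => ⟨hz.1, ?_⟩
  rw [hq]
  simp only [evalEval_sub, evalEval_add, evalEval_mul, ← mul_deriv_evalEval (hS z hz.1), hz.2,
    map_zero, mul_zero, add_zero, sub_zero]

/-- On the solutions of the differential equation, a differential polynomial is a polynomial in
`z` and `z'`, up to a power of `D(z)`. -/
lemma exists_evalEval_eq_diffEval {D N : U[X]} {S : Set U}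
    (hS : ∀ z ∈ S, D.eval z * z′′ = N.eval z * z′) (P : MvPolynomial ℕ U) :
    ∃ (k : ℕ) (p : U[X][X]), ∀ z ∈ S, D.eval z ^ k * diffEval P z = p.evalEval z z′ := by
  induction P using MvPolynomial.induction_on with
  | C a => exact ⟨0, C (C a), fun z _ => by simp [diffEval]⟩
  | add P Q hP hQ =>
    obtain ⟨k, p, hp⟩ := hP
    obtain ⟨l, q, hq⟩ := hQ
    refine ⟨k + l, C (D ^ l) * p + C (D ^ k) * q, fun z hz => ?_⟩
    simp only [evalEval_add, evalEval_mul, evalEval_C, ← hp z hz, ← hq z hz, diffEval, map_add,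
      eval_pow]
    ring
  | mul_X P i hP =>
    obtain ⟨k, p, hp⟩ := hP
    obtain ⟨l, q, hq⟩ : ∃ (l : ℕ) (q : U[X][X]), ∀ z ∈ S,
        D.eval z ^ l * (fun x : U => x′)^[i] z = q.evalEval z z′ := by
      clear hp
      induction i with
      | zero => exact ⟨0, C X, fun z _ => by simp [evalEval_C]⟩
      | succ i hi =>
        obtain ⟨l, q, hq⟩ := hi
        -- Differentiate `D^l z⁽ⁱ⁾ = q(z, z')`, multiply by `D`, and remove the term coming from
        -- `(D^l)'`.
        refine ⟨l + 1, vectorField D N q - (l : U[X][X]) *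
          (C (Differential.mapCoeffs D) + X * C (derivative D)) * q, fun z hz => ?_⟩
        rw [Function.iterate_succ_apply', evalEval_sub, ← mul_deriv_evalEval (hS z hz),
          evalEval_mul, evalEval_mul, evalEval_add, evalEval_mul, evalEval_C, evalEval_C,
          evalEval_X, evalEval_natCast, ← hq z hz]
        simp only [Derivation.leibniz, Derivation.leibniz_pow, smul_eq_mul, deriv_eval,
          nsmul_eq_mul]
        obtain _ | l := l
        · simp
        · simp only [Nat.add_sub_cancel]
          push_cast
          ring
    refine ⟨k + l, p * q, fun z hz => ?_⟩
    simp only [evalEval_mul, ← hp z hz, ← hq z hz, diffEval, map_mul, MvPolynomial.eval_X]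
    ring

end VectorField

/-! ### Reduction of minimality to single differential polynomials. -/

section Definable

variable {U : Type*} [Field U] [Differential U]

lemma isKolchinClosed_setOf_diffEval (P : MvPolynomial ℕ U) :
    IsKolchinClosed {z : U | diffEval P z = 0} :=
  ⟨{P}, by simp⟩

lemma IsDefinable.inter {S T : Set U} (hS : IsDefinable S) (hT : IsDefinable T) :
    IsDefinable (S ∩ T) :=
  BooleanSubalgebra.inf_mem hS hT

lemma IsDefinable.compl {S : Set U} (hS : IsDefinable S) : IsDefinable Sᶜ :=
  BooleanSubalgebra.compl_mem hS

lemma isDefinable_setOf_diffEval (P : MvPolynomial ℕ U) :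
    IsDefinable {z : U | diffEval P z = 0} :=
  BooleanSubalgebra.subset_closure (isKolchinClosed_setOf_diffEval P)

/-- Minimality of a set need only be tested on zero sets of single differential polynomials. -/
lemma finite_or_finite_diff_of_isDefinable {S : Set U}
    (h : ∀ P : MvPolynomial ℕ U, (S ∩ {z | diffEval P z = 0}).Finite ∨
      (S \ {z | diffEval P z = 0}).Finite) {Y : Set U} (hY : IsDefinable Y) :
    (S ∩ Y).Finite ∨ (S \ Y).Finite := by
  induction hY using BooleanSubalgebra.closure_bot_sup_induction with
  | mem Y hY =>
    obtain ⟨F, rfl⟩ := hY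
    by_cases hF : ∃ P ∈ F, (S ∩ {z | diffEval P z = 0}).Finite
    · obtain ⟨P, hP, hfin⟩ := hF
      exact Or.inl (hfin.subset fun z hz => ⟨hz.1, hz.2 P hP⟩)
    · push Not at hF
      refine Or.inr ((F.finite_toSet.biUnion fun P hP =>
        (h P).resolve_left (hF P hP)).subset fun z hz => ?_)
      obtain ⟨P, hP, hz'⟩ : ∃ P ∈ F, diffEval P z ≠ 0 := by simpa using hz.2
      exact Set.mem_biUnion (show P ∈ (F : Set _) from hP) ⟨hz.1, hz'⟩
  | bot => exact Or.inl (by simp)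
  | sup Y hY Z hZ ihY ihZ =>
    obtain hfY | hfY := ihY
    · obtain hfZ | hfZ := ihZ
      · exact Or.inl ((hfY.union hfZ).subset
          (Set.inter_union_distrib_left S Y Z).subset)
      · exact Or.inr (hfZ.subset (Set.sdiff_subset_sdiff_right Set.subset_union_right))
    · exact Or.inr (hfY.subset (Set.sdiff_subset_sdiff_right Set.subset_union_left))
  | compl Y hY ih =>
    rw [← Set.sdiff_eq, Set.sdiff_compl]
    exact ih.symm

end Definable

/-! ### Orders of differential polynomials and infinitude of zero sets. -/

section DiffPoly

variable {U : Type*} [Field U]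

/-- The differential polynomial `a(z)`. -/
noncomputable def ofPoly (a : U[X]) : MvPolynomial ℕ U :=
  Polynomial.aeval (MvPolynomial.X 0) a

lemma vars_ofPoly_subset (a : U[X]) : (ofPoly a).vars ⊆ {0} := by
  classical
  rw [ofPoly, aeval_eq_sum_range]
  refine (MvPolynomial.vars_sum_subset _ _).trans (Finset.biUnion_subset.2 fun i _ => ?_)
  rw [MvPolynomial.smul_eq_C_mul]
  refine (MvPolynomial.vars_mul _ _).trans ?_
  rw [MvPolynomial.vars_C, Finset.empty_union]
  exact (MvPolynomial.vars_pow _ _).trans MvPolynomial.vars_X.subset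

lemma ofPoly_ne_zero {a : U[X]} (ha : a ≠ 0) : ofPoly a ≠ 0 := by
  intro h
  apply ha
  have : MvPolynomial.aeval (fun _ : ℕ => (X : U[X])) (ofPoly a) = a := by
    rw [ofPoly, ← aeval_algHom_apply, MvPolynomial.aeval_X, aeval_X_left_apply]
  rw [← this, h, map_zero]

/-- The partial derivative in the variable `n + 1` is `ofPoly a`, which is nonzero. -/
lemma mem_vars_mul_X_sub {a : U[X]} (ha : a ≠ 0) {n : ℕ} {R : MvPolynomial ℕ U}
    (hR : n + 1 ∉ R.vars) : n + 1 ∈ (ofPoly a * MvPolynomial.X (n + 1) - R).vars := by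
  by_contra h
  have h' := MvPolynomial.pderiv_eq_zero_of_notMem_vars h
  have ha' : n + 1 ∉ (ofPoly a).vars := fun hn => by
    simpa using vars_ofPoly_subset a hn
  rw [map_sub, MvPolynomial.pderiv_eq_zero_of_notMem_vars hR, Derivation.leibniz,
    MvPolynomial.pderiv_eq_zero_of_notMem_vars ha', MvPolynomial.pderiv_X_self] at h'
  exact ofPoly_ne_zero ha (by simpa using h')

variable [Differential U]

lemma diffEval_ofPoly (a : U[X]) (z : U) : diffEval (ofPoly a) z = a.eval z := by
  have := Polynomial.hom_eval₂ a (algebraMap U (MvPolynomial ℕ U))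
    (MvPolynomial.eval fun i : ℕ => (fun x : U => x′)^[i] z) (MvPolynomial.X 0)
  rw [diffEval, ofPoly, aeval_def, this, eval, MvPolynomial.eval_X]
  congr 1
  ext x
  simp [MvPolynomial.algebraMap_eq]

/-- In a differentially closed field, a differential polynomial in which `z⁽ⁿ⁺¹⁾` occurs has
infinitely many zeros outside the zero set of a given differential polynomial of order at most
`n`. -/
lemma IsDifferentiallyClosed.infinite_zeros (hU : IsDifferentiallyClosed U)
    {P Q : MvPolynomial ℕ U} {n : ℕ} (hQ : Q ≠ 0) (hQn : ∀ i ∈ Q.vars, i ≤ n)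
    (hP : n + 1 ∈ P.vars) : {z : U | diffEval P z = 0 ∧ diffEval Q z ≠ 0}.Infinite := by
  classical
  intro hfin
  -- Multiplying `Q` by a polynomial in `z` vanishing on the supposedly finite set keeps the order
  -- at most `n`, so Blum's axiom yields one more zero.
  obtain ⟨b, hb⟩ : ∃ b : U[X], b = ∏ a ∈ hfin.toFinset, (X - C a) := ⟨_, rfl⟩
  have hb0 : b ≠ 0 := by
    rw [hb, Finset.prod_ne_zero_iff]
    exact fun a _ => X_sub_C_ne_zero a
  obtain ⟨z, hPz, hQz⟩ := hU.exists_zero P (Q * ofPoly b) (mul_ne_zero hQ (ofPoly_ne_zero hb0)) (by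
    refine lt_of_le_of_lt (b := (n : WithBot ℕ)) (Finset.max_le fun i hi => ?_)
      (lt_of_lt_of_le (WithBot.coe_lt_coe.2 n.lt_succ_self) (Finset.le_max hP))
    obtain hi | hi := Finset.mem_union.1 (MvPolynomial.vars_mul _ _ hi)
    · exact WithBot.coe_le_coe.2 (hQn i hi)
    · rw [Finset.mem_singleton.1 (vars_ofPoly_subset b hi)]
      exact WithBot.coe_le_coe.2 n.zero_le)
  rw [diffEval, map_mul, ← diffEval, ← diffEval, diffEval_ofPoly] at hQz
  apply right_ne_zero_of_mul hQz
  rw [hb, eval_prod]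
  exact Finset.prod_eq_zero (hfin.mem_toFinset.2 ⟨hPz, left_ne_zero_of_mul hQz⟩) (by simp)

end DiffPoly

/-! ### The two directions for the equation `z'' = z' f(z)`. -/

section Main

variable {U : Type*} [Field U] [Differential U] [Algebra ℂ U]

/-- A nonconstant element is transcendental over `ℂ`: an algebraic one lies in `ℂ`, which is
algebraically closed. -/
lemma aeval_ne_zero_of_deriv_ne_zero (hconst : ∀ c : ℂ, (algebraMap ℂ U c)′ = 0) {z : U}
    (hz : z′ ≠ 0) {q : ℂ[X]} (hq : q ≠ 0) : aeval z q ≠ 0 := by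
  intro h
  have hint : IsIntegral ℂ z := isAlgebraic_iff_isIntegral.1 ⟨q, hq, h⟩
  obtain ⟨c, rfl⟩ := minpoly.mem_range_of_degree_eq_one ℂ z
    (IsAlgClosed.degree_eq_one_of_irreducible ℂ (minpoly.irreducible hint))
  exact hz (hconst c)

lemma mapCoeffs_map_eq_zero (hconst : ∀ c : ℂ, (algebraMap ℂ U c)′ = 0) (q : ℂ[X]) :
    Differential.mapCoeffs (q.map (algebraMap ℂ U)) = 0 := by
  ext n
  simp [hconst]

lemma deriv_aeval_const (hconst : ∀ c : ℂ, (algebraMap ℂ U c)′ = 0) (q : ℂ[X]) (z : U) :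
    (aeval z q)′ = aeval z (derivative q) * z′ := by
  have := deriv_eval (q.map (algebraMap ℂ U)) z
  rwa [mapCoeffs_map_eq_zero hconst, derivative_map, eval_map_algebraMap, eval_map_algebraMap,
    eval_zero, zero_add] at this

lemma mem_solutionSet_iff (hconst : ∀ c : ℂ, (algebraMap ℂ U c)′ = 0) {f : RatFunc ℂ} {z : U} :
    z ∈ solutionSet U f ↔
      aeval z f.denom * z′′ = aeval z f.num * z′ ∧ z′ ≠ 0 := by
  refine and_congr_left fun hz => ?_
  rw [ratEval, ← mul_div_assoc,
    eq_div_iff (aeval_ne_zero_of_deriv_ne_zero hconst hz f.denom_ne_zero), mul_comm z′′,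
    mul_comm z′]

lemma infinite_setOf_order_one (hU : IsDifferentiallyClosed U) {a b : ℂ[X]} (ha : a ≠ 0)
    (hb : b ≠ 0) : {z : U | aeval z b * z′ = aeval z a ∧ z′ ≠ 0}.Infinite := by
  have hinj := (algebraMap ℂ U).injective
  have ha' : a.map (algebraMap ℂ U) ≠ 0 := (Polynomial.map_ne_zero_iff hinj).2 ha
  have hb' : b.map (algebraMap ℂ U) ≠ 0 := (Polynomial.map_ne_zero_iff hinj).2 hb
  refine (hU.infinite_zeros (n := 0) (ofPoly_ne_zero ha') (fun i hi => ?_)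
    (mem_vars_mul_X_sub hb' (R := ofPoly (a.map (algebraMap ℂ U))) fun h => ?_)).mono ?_
  · exact (Finset.mem_singleton.1 (vars_ofPoly_subset _ hi)).le
  · simpa using vars_ofPoly_subset _ h
  · rintro z ⟨h1, h2⟩
    rw [diffEval_ofPoly, eval_map_algebraMap] at h2
    rw [diffEval, map_sub, map_mul, MvPolynomial.eval_X, ← diffEval, ← diffEval, diffEval_ofPoly,
      diffEval_ofPoly, eval_map_algebraMap, eval_map_algebraMap, sub_eq_zero] at h1
    refine ⟨h1, fun h0 => h2 ?_⟩
    rw [← h1]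
    simp [h0]

lemma infinite_solutionSet (hU : IsDifferentiallyClosed U)
    (hconst : ∀ c : ℂ, (algebraMap ℂ U c)′ = 0) (f : RatFunc ℂ) :
    (solutionSet U f).Infinite := by
  classical
  have hb' : f.denom.map (algebraMap ℂ U) ≠ 0 :=
    (Polynomial.map_ne_zero_iff (algebraMap ℂ U).injective).2 f.denom_ne_zero
  refine (hU.infinite_zeros (n := 1) (Q := MvPolynomial.X 1) (MvPolynomial.X_ne_zero 1)
    (fun i hi => ?_)
    (mem_vars_mul_X_sub hb' (R := ofPoly (f.num.map (algebraMap ℂ U)) * MvPolynomial.X 1)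
      fun h => ?_)).mono ?_
  · rw [MvPolynomial.vars_X] at hi
    exact (Finset.mem_singleton.1 hi).le
  · obtain h | h := Finset.mem_union.1 (MvPolynomial.vars_mul _ _ h)
    · simpa using vars_ofPoly_subset _ h
    · rw [MvPolynomial.vars_X] at h
      simp at h
  · rintro z ⟨h1, h2⟩
    rw [diffEval, MvPolynomial.eval_X] at h2
    rw [diffEval, map_sub, map_mul, map_mul, MvPolynomial.eval_X, MvPolynomial.eval_X, ← diffEval,
      ← diffEval, diffEval_ofPoly, diffEval_ofPoly, eval_map_algebraMap, eval_map_algebraMap,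
      sub_eq_zero] at h1
    exact (mem_solutionSet_iff hconst).2 ⟨h1, h2⟩

lemma isDefinable_setOf_order_one (a b : ℂ[X]) :
    IsDefinable {z : U | aeval z b * z′ = aeval z a} := by
  convert! isDefinable_setOf_diffEval (ofPoly (b.map (algebraMap ℂ U)) * MvPolynomial.X 1 -
    ofPoly (a.map (algebraMap ℂ U))) using 3 with z
  rw [diffEval, map_sub, map_mul, MvPolynomial.eval_X, ← diffEval, ← diffEval, diffEval_ofPoly,
      diffEval_ofPoly, eval_map_algebraMap, eval_map_algebraMap, sub_eq_zero]
  rfl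

lemma isDefinable_solutionSet (hconst : ∀ c : ℂ, (algebraMap ℂ U c)′ = 0) (f : RatFunc ℂ) :
    IsDefinable (solutionSet U f) := by
  convert! (isDefinable_setOf_diffEval (ofPoly (f.denom.map (algebraMap ℂ U)) *
    MvPolynomial.X 2 - ofPoly (f.num.map (algebraMap ℂ U)) * MvPolynomial.X 1)).inter
    (isDefinable_setOf_diffEval (MvPolynomial.X 1)).compl using 1
  ext z
  rw [mem_solutionSet_iff hconst, Set.mem_inter_iff, Set.mem_compl_iff, Set.mem_ofPred_eq,
    Set.mem_ofPred_eq]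
  rw [diffEval, map_sub, map_mul, map_mul, MvPolynomial.eval_X, MvPolynomial.eval_X, ← diffEval,
      ← diffEval, diffEval_ofPoly, diffEval_ofPoly, eval_map_algebraMap, eval_map_algebraMap,
      sub_eq_zero, diffEval, MvPolynomial.eval_X]
  rfl

/-- If `f = dg/dz` then solutions of `z' = g(z)` are solutions of `z'' = z' f(z)`. -/
lemma mem_solutionSet_of_ratDeriv (hconst : ∀ c : ℂ, (algebraMap ℂ U c)′ = 0) {f g : RatFunc ℂ}
    (hf : f = ratDeriv g) {z : U} (hz : aeval z g.denom * z′ = aeval z g.num) (hz' : z′ ≠ 0) :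
    z ∈ solutionSet U f := by
  rw [mem_solutionSet_iff hconst]
  refine ⟨?_, hz'⟩
  have hd := aeval_ne_zero_of_deriv_ne_zero hconst hz' g.denom_ne_zero
  have h1 : f.num * g.denom ^ 2 =
      (derivative g.num * g.denom - g.num * derivative g.denom) * f.denom := by
    apply RatFunc.algebraMap_injective ℂ
    rw [← f.num_div_denom, ratDeriv, ← map_pow, div_eq_div_iff
      (algebraMap_ratFunc_ne_zero f.denom_ne_zero)
      (algebraMap_ratFunc_ne_zero (pow_ne_zero 2 g.denom_ne_zero)), ← map_mul, ← map_mul] at hf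
    simpa only [f.num_div_denom] using hf
  have h2 := congrArg (aeval z) h1
  simp only [map_mul, map_sub, map_pow] at h2
  have h3 := congrArg (fun x : U => x′) hz
  simp only [Derivation.leibniz, smul_eq_mul, deriv_aeval_const hconst] at h3
  apply mul_left_cancel₀ (pow_ne_zero 2 hd)
  linear_combination aeval z f.denom * aeval z g.denom * h3 - z′ * h2 -
    aeval z f.denom * aeval z (derivative g.denom) * z′ * hz

/-- The solutions of `z' = g(z)` and of `z' = h(z)` with `z' ≠ 0` form two infinite subsets. They
are disjoint, since `g(z) = h(z)` would make `z` algebraic over `ℂ`. -/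
lemma not_isStronglyMinimal_of_ratDeriv (hU : IsDifferentiallyClosed U)
    (hconst : ∀ c : ℂ, (algebraMap ℂ U c)′ = 0) {f g h : RatFunc ℂ} (hg : f = ratDeriv g)
    (hh : f = ratDeriv h) (hg0 : g ≠ 0) (hh0 : h ≠ 0) (hgh : g ≠ h) :
    ¬ IsStronglyMinimal (solutionSet U f) := by
  rintro ⟨hdef, -, hmin⟩
  obtain hfin | hfin := hmin _ Set.inter_subset_left
    (hdef.inter (isDefinable_setOf_order_one g.num g.denom))
  · exact infinite_setOf_order_one hU (RatFunc.num_ne_zero hg0) g.denom_ne_zero (hfin.subset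
      fun z hz => ⟨mem_solutionSet_of_ratDeriv hconst hg hz.1 hz.2, hz.1⟩)
  · refine infinite_setOf_order_one hU (RatFunc.num_ne_zero hh0) h.denom_ne_zero (hfin.subset
      fun z hz => ⟨mem_solutionSet_of_ratDeriv hconst hh hz.1 hz.2, fun hz' => hgh ?_⟩)
    have hne : g.num * h.denom - h.num * g.denom ≠ 0 := fun h0 => hgh (by
      rw [← g.num_div_denom, ← h.num_div_denom, div_eq_div_iff
        (algebraMap_ratFunc_ne_zero g.denom_ne_zero) (algebraMap_ratFunc_ne_zero h.denom_ne_zero),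
        ← map_mul, ← map_mul, sub_eq_zero.1 h0])
    refine absurd ?_ (aeval_ne_zero_of_deriv_ne_zero hconst hz.2 hne)
    rw [map_sub, map_mul, map_mul, ← hz.1, ← hz'.2.out]
    ring

lemma ratDeriv_C (c : ℂ) : ratDeriv (RatFunc.C c) = 0 := by
  simp [ratDeriv]

/-- The antiderivatives must be nonzero because `z' = 0` contributes no point to the solution set.
-/
lemma exists_ne_ratDeriv_eq (g : RatFunc ℂ) :
    ∃ g₁ g₂ : RatFunc ℂ, g₁ ≠ 0 ∧ g₂ ≠ 0 ∧ g₁ ≠ g₂ ∧ ratDeriv g = ratDeriv g₁ ∧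
      ratDeriv g = ratDeriv g₂ := by
  by_cases hg : ∃ c, g = RatFunc.C c
  · obtain ⟨c, rfl⟩ := hg
    refine ⟨RatFunc.C 1, RatFunc.C 2, by simp, by simp, ?_, ?_, ?_⟩
    · rw [Ne, RatFunc.C_injective.eq_iff]; norm_num
    · simp only [ratDeriv_C]
    · simp only [ratDeriv_C]
  · refine ⟨g, g + RatFunc.C 1, fun h => hg ⟨0, by simpa using h⟩,
      fun h => hg ⟨-1, by rw [map_neg]; exact eq_neg_of_add_eq_zero_left h⟩, by simp, rfl, ?_⟩
    rw [ratDeriv_add, ratDeriv_C, add_zero]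

/-- If `f` is not a derivative then the equation `z'' = z' f(z)` has no invariant curves. -/
lemma darboux_identity_ne (hchar : CharZero U) (hconst : ∀ c : ℂ, (algebraMap ℂ U c)′ = 0)
    {f : RatFunc ℂ} (hf : ∀ g : RatFunc ℂ, f ≠ ratDeriv g) (n : ℕ) (a b r : U[X]) (hn : n ≠ 0)
    (ha : a ≠ 0) (hb : b ≠ 0) :
    b ^ 2 * (f.denom.map (algebraMap ℂ U) * Differential.mapCoeffs a) ≠
      (b * (f.denom.map (algebraMap ℂ U) * Differential.mapCoeffs b +
        f.denom.map (algebraMap ℂ U) * derivative r +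
        f.num.map (algebraMap ℂ U) * ((n : U[X]) * b)) -
        f.denom.map (algebraMap ℂ U) * derivative b * r) * a := by
  intro H
  have hinj := (algebraMap ℂ U).injective
  obtain ⟨g, hg⟩ | ⟨g, c, A, B, hA, hB, hg⟩ :=
    exists_ratDeriv_or_simple_pole f.num f.denom f.denom_ne_zero
  · exact hf g (by rw [← hg, f.num_div_denom])
  have hB0 : B ≠ 0 := by rintro rfl; simp at hB
  have h1 : f.num * (g.denom ^ 2 * ((X - C c) * B)) =
      ((derivative g.num * g.denom - g.num * derivative g.denom) * ((X - C c) * B) +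
        g.denom ^ 2 * A) * f.denom := by
    apply RatFunc.algebraMap_injective ℂ
    have hgd : g.denom ^ 2 ≠ 0 := pow_ne_zero 2 g.denom_ne_zero
    have htB : (X - C c) * B ≠ 0 := mul_ne_zero (X_sub_C_ne_zero c) hB0
    rwa [ratDeriv, ← map_pow, div_add_div _ _ (algebraMap_ratFunc_ne_zero hgd)
      (algebraMap_ratFunc_ne_zero htB), ← map_mul, ← map_mul, ← map_mul, ← map_add,
      div_eq_div_iff (algebraMap_ratFunc_ne_zero f.denom_ne_zero)
      (algebraMap_ratFunc_ne_zero (mul_ne_zero hgd htB)), ← map_mul, ← map_mul] at hg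
  have h2 := congrArg (map (algebraMap ℂ U)) h1
  simp only [Polynomial.map_mul, Polynomial.map_add, Polynomial.map_sub, Polynomial.map_pow,
    map_X, map_C, ← derivative_map] at h2
  have hD : f.denom.map (algebraMap ℂ U) ≠ 0 :=
    (Polynomial.map_ne_zero_iff hinj).2 f.denom_ne_zero
  have hgd : g.denom.map (algebraMap ℂ U) ≠ 0 :=
    (Polynomial.map_ne_zero_iff hinj).2 g.denom_ne_zero
  generalize f.denom.map (algebraMap ℂ U) = D at *
  generalize f.num.map (algebraMap ℂ U) = N at *
  generalize g.denom.map (algebraMap ℂ U) = gd at *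
  generalize g.num.map (algebraMap ℂ U) = gn at *
  have hA' : ((n : U[X]) * A.map (algebraMap ℂ U)).eval (algebraMap ℂ U c) ≠ 0 := by
    rw [eval_mul, eval_natCast, eval_map_algebraMap, aeval_algebraMap_apply]
    exact mul_ne_zero (Nat.cast_ne_zero.2 hn) ((map_ne_zero_iff _ hinj).2 (by simpa using hA))
  have hB' : (B.map (algebraMap ℂ U)).eval (algebraMap ℂ U c) ≠ 0 := by
    rw [eval_map_algebraMap, aeval_algebraMap_apply]
    exact (map_ne_zero_iff _ hinj).2 (by simpa using hB)
  -- Here `u/v = -(r/b + n g)`: the identity `H` expresses `n (f - g')`, with its simple pole at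
  -- `c`, as `(u/v)' + δa/a - δb/b`.
  refine not_simple_pole Differential.mapCoeffs (a := algebraMap ℂ U c)
    (u := -(r * gd + n * b * gn)) (v := b * gd) (p := a) (q := b) ?_ (mul_ne_zero hb hgd) ha hb
    hA' hB' ?_
  · simp [hconst]
  · apply mul_left_cancel₀ hD
    simp only [derivative_mul, derivative_neg, derivative_add, derivative_natCast]
    linear_combination (-(X - C (algebraMap ℂ U c)) * B.map (algebraMap ℂ U) * gd ^ 2 * b) * H -
      (n * b ^ 3 * a) * h2

lemma isStronglyMinimal_solutionSet (hU : IsDifferentiallyClosed U)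
    (hconst : ∀ c : ℂ, (algebraMap ℂ U c)′ = 0) {f : RatFunc ℂ}
    (hf : ∀ g : RatFunc ℂ, f ≠ ratDeriv g) : IsStronglyMinimal (solutionSet U f) := by
  refine ⟨isDefinable_solutionSet hconst f, infinite_solutionSet hU hconst f, fun Y hYS hY => ?_⟩
  have hS : ∀ z ∈ solutionSet U f, (f.denom.map (algebraMap ℂ U)).eval z * z′′ =
      (f.num.map (algebraMap ℂ U)).eval z * z′ := fun z hz => by
    simpa only [eval_map_algebraMap] using ((mem_solutionSet_iff hconst).1 hz).1
  have key := finite_or_finite_diff_of_isDefinable (S := solutionSet U f) (fun P => ?_) hY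
  · rwa [Set.inter_eq_right.2 hYS] at key
  obtain ⟨k, p, hp⟩ := exists_evalEval_eq_diffEval hS P
  have hiff : ∀ z ∈ solutionSet U f, diffEval P z = 0 ↔ p.evalEval z z′ = 0 := fun z hz => by
    have hd : (f.denom.map (algebraMap ℂ U)).eval z ≠ 0 := by
      rw [eval_map_algebraMap]
      exact aeval_ne_zero_of_deriv_ne_zero hconst hz.2 f.denom_ne_zero
    rw [← hp z hz, mul_eq_zero, or_iff_right (pow_ne_zero k hd)]
  by_cases hp0 : p = 0
  · right
    convert Set.finite_empty
    refine Set.sdiff_eq_empty.2 fun z hz => (hiff z hz).2 ?_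
    simp [hp0]
  · left
    refine (finite_setOf_evalEval_eq_zero hS (fun z hz => hz.2)
      (darboux_identity_ne hU.charZero hconst hf) p hp0).subset fun z hz => ?_
    exact ⟨hz.1, (hiff z hz.1).1 hz.2⟩

end Main

end Poizat

theorem theorem3p1 {U : Type*} [Field U] [Differential U] [Algebra ℂ U]
    (hU : Poizat.IsDifferentiallyClosed U)
    (hconst : ∀ c : ℂ, (algebraMap ℂ U c)′ = 0)
    (f : RatFunc ℂ) :
    Poizat.IsStronglyMinimal (Poizat.solutionSet U f) ↔
      ∀ g : RatFunc ℂ, f ≠ Poizat.ratDeriv g := by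
  refine ⟨fun h g hg => ?_, Poizat.isStronglyMinimal_solutionSet hU hconst⟩
  obtain ⟨g₁, g₂, h₁, h₂, hne, hg₁, hg₂⟩ := Poizat.exists_ne_ratDeriv_eq g
  exact Poizat.not_isStronglyMinimal_of_ratDeriv hU hconst (hg.trans hg₁) (hg.trans hg₂) h₁ h₂
    hne h
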